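/- **Theorem 2.2.** Let $\mathcal C\subseteq\mathbb R$ be an interval, $\mathcal I$ a countable set, and $\mathbb P$ a probability measure on $\Omega=\mathcal C^{\mathcal I}$ with the product Borel $\sigma$-algebra $\mathfrak F$. Let $\mathcal I_F\subseteq\mathcal I$ be finite and let $\mathbf 1_F\in\mathbb R^{\mathcal I}$ be $1$ on $\mathcal I_F$ and $0$ elsewhere. For $0<\varepsilon\le\infty$ put $$s_F(\mathbb P,\varepsilon)=\max_{\alpha\in\mathcal I_F}\mathbb E\Big\{\sup_{E\in\mathbb R}\mu_{\hat\omega_\alpha}\big((E,E+\varepsilon)\big)\Big\},$$ where $\hat\omega_\alpha=(\omega_\beta)_{\beta\ne\alpha}$ and $\mu_{\hat\omega_\alpha}$ is the regular conditional distribution of $\omega_\alpha$ given $\hat\omega_\alpha$ (a maximum over the empty set, and $s_F(\mathbb P,0)$, are $0$). Assume $s_F(\mathbb P,\varepsilon)\to0$ as $\varepsilon\downarrow0$. Let $\mathcal H$ be a separable real or complex Hilbert space and, for each $\omega\in\Omega$, let $H(\omega)$ be a self-adjoint operator on $\mathcal H$, bounded from below, that has an orthonormal basis of eigenvectors with eigenvalues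 $\lambda_1(\omega)\le\lambda_2(\omega)\le\dots$ (a finite or infinite sequence, repeated according to multiplicity). Let $I\subseteq\mathbb R$ be an open interval of length $|I|\in[0,\infty]$, and let $K\ge0$ be a number independent of $\omega$ such that $\lambda_n(\omega)\notin I$ for all $n>K$ and all $\omega$. Assume that one of the following holds: * the operator domain $\mathcal D=D(H(\omega))$ does not depend on $\omega$; then put $f_u(\omega)=\langle H(\omega)u,u\rangle$ for $u\in\mathcal D$; * the domain $\mathcal D=D(\mathfrak h^\omega)$ of the closed quadratic form $\mathfrak h^\omega$ associated with $H(\omega)$ does not depend on $\omega$; then put $f_u(\omega)=\mathfrak h^\omega[u]$ for $u\in\mathcal D$. Assume that for every $u\in\mathcal D$ the function $f_u:\Omega\to\mathbb R$ depends only on $(\omega_\alpha)_{\alpha\in\mathcal I_F}$, and that there is $\gamma>0$ such that for every $u\in\mathcal D$ at least one of the following holds: * (a) $f_u$ is increasing in the coordinatewise order, and $f_u(\omega)-f_u(\omega-t\mathbf 1_F)\ge t\gamma\|u\|^2$ whenever $t\ge0$ and $\omega,\ \omega-t\mathbf 1_F\in\Omega$; * (b) as a function of $(\omega_\alpha)_{\alpha\in\mathcal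 I_F}$, $f_u$ is continuous on $\mathcal C^{\mathcal I_F}$ and continuously differentiable in the interior of $\mathcal C^{\mathcal I_F}$, where $\partial f_u/\partial\omega_\alpha\ge0$ for all $\alpha\in\mathcal I_F$ and $\sum_{\alpha\in\mathcal I_F}\partial f_u/\partial\omega_\alpha\ge\gamma\|u\|^2$; * (c) $f_u$ is decreasing in the coordinatewise order, and $f_u(\omega)-f_u(\omega-t\mathbf 1_F)\le-t\gamma\|u\|^2$ whenever $t\ge0$ and $\omega,\ \omega-t\mathbf 1_F\in\Omega$; * (d) the regularity of (b) holds, with $\partial f_u/\partial\omega_\alpha\le0$ for all $\alpha\in\mathcal I_F$ and $\sum_{\alpha\in\mathcal I_F}\partial f_u/\partial\omega_\alpha\le-\gamma\|u\|^2$ in the interior of $\mathcal C^{\mathcal I_F}$. Then $\omega\mapsto\operatorname{tr}[\chi_I(H(\omega))]$ is measurable with respect to the $\mathbb P$-completion of $\mathfrak F$, and $$\overline{\mathbb E}\big\{\operatorname{tr}[\chi_I(H(\omega))]\big\}\le 2K\cdot|\mathcal I_F|\cdot s_F\Big(\mathbb P,\frac{|I|}{\gamma}\Big),$$ where $\overline{\mathbb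 E}$ is the expectation with respect to the completion of $\mathbb P$. -/

import Mathlib

open MeasureTheory Filter Topology
open scoped ENNReal NNReal

noncomputable section

namespace Wegner

section Operators

variable {𝕜 E : Type*} [RCLike 𝕜] [NormedAddCommGroup E] [InnerProductSpace 𝕜 E]

/-- The quadratic functional `u ↦ ⟨T u, u⟩` of an operator `T`, for `u` in the domain of `T`.
It is real for symmetric `T`. -/
def quad (T : E →ₗ.[𝕜] E) (u : T.domain) : ℝ :=
  RCLike.re (inner 𝕜 (T u) (u : E))

/-- `T` is bounded from below. -/
def BoundedBelow (T : E →ₗ.[𝕜] E) : Prop :=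
  ∃ c : ℝ, ∀ u : T.domain, c * ‖(u : E)‖ ^ 2 ≤ quad T u

/-- The sequence `v` in the domain of `T` converges to `u` in the Hilbert space and is a Cauchy
sequence for the quadratic form of `T`. -/
def FormApprox (T : E →ₗ.[𝕜] E) (v : ℕ → T.domain) (u : E) : Prop :=
  Tendsto (fun n => (v n : E)) atTop (𝓝 u) ∧
    Tendsto (fun p : ℕ × ℕ => quad T (v p.1 - v p.2)) atTop (𝓝 0)

/-- `h`, with domain `D`, is the closed quadratic form associated with `T` (used for self-adjoint
`T` that are bounded from below): the closure of the form `u ↦ ⟨T u, u⟩` defined on the domain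
of `T`. -/
def IsAssociatedForm (T : E →ₗ.[𝕜] E) (D : Set E) (h : E → ℝ) : Prop :=
  D = {u | ∃ v : ℕ → T.domain, FormApprox T v u} ∧
    ∀ (u : E) (v : ℕ → T.domain), FormApprox T v u →
      Tendsto (fun n => quad T (v n)) atTop (𝓝 (h u))

/-- `f`, with domain `D`, is the functional `u ↦ ⟨T u, u⟩` on the operator domain of `T`. -/
def IsOperatorForm (T : E →ₗ.[𝕜] E) (D : Set E) (f : E → ℝ) : Prop :=
  D = (T.domain : Set E) ∧ ∀ u : T.domain, f u = quad T u

/-- `T` has an orthonormal basis of eigenvectors, with eigenvalues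
`lam 0 ≤ lam 1 ≤ …` repeated according to multiplicity. Here `N` is the dimension of the
space, finite or infinite. -/
def HasOrderedEigenbasis (T : E →ₗ.[𝕜] E) (N : ℕ∞) (lam : {n : ℕ // (n : ℕ∞) < N} → ℝ) : Prop :=
  Monotone lam ∧ ∃ b : HilbertBasis {n : ℕ // (n : ℕ∞) < N} 𝕜 E,
    ∀ n, ∃ h : b n ∈ T.domain, T ⟨b n, h⟩ = (lam n : 𝕜) • b n

/-- The linear span of all eigenvectors of `T` whose eigenvalue lies in `S`. -/
def eigenSpan (T : E →ₗ.[𝕜] E) (S : Set ℝ) : Submodule 𝕜 E :=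
  Submodule.span 𝕜 {u | ∃ h : u ∈ T.domain, ∃ μ ∈ S, T ⟨u, h⟩ = (μ : 𝕜) • u}

variable [CompleteSpace E]

/-- The spectral projection `χ_S(T)` of a self-adjoint operator `T` that has an orthonormal basis
of eigenvectors: the orthogonal projection onto the closed span of the eigenvectors whose
eigenvalue lies in `S`. -/
def spectralProj (T : E →ₗ.[𝕜] E) (S : Set ℝ) : E →L[𝕜] E :=
  (eigenSpan T S).topologicalClosure.starProjection

/-- The trace, in `[0, ∞]`, of a nonnegative bounded operator: the sum of `⟨A v, v⟩` over an
orthonormal basis of the space. -/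
def posTrace (A : E →L[𝕜] E) : ℝ≥0∞ :=
  ∑' v : (exists_hilbertBasis 𝕜 E).choose, ENNReal.ofReal (RCLike.re (inner 𝕜 (A v) (v : E)))

end Operators

section Randomness

variable {ι : Type*} {C : Set ℝ}

/-- The open interval `(E, E + ε)`, where `ε = ∞` is allowed. -/
def openInterval (E : ℝ) (ε : ℝ≥0∞) : Set ℝ :=
  {x | E < x ∧ ENNReal.ofReal (x - E) < ε}

/-- The restriction of `ω` to the coordinates other than `α`. -/
def others (α : ι) (ω : ι → C) : {β : ι // β ≠ α} → C := fun β => ω β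

/-- The modulus of continuity `s_F(P, ε)`: the maximum over `α ∈ F` of the expectation of the
supremum over `E` of `μ (E, E + ε)`, where `μ` is the regular conditional distribution of the
coordinate `ω α` given all the other coordinates. -/
def modulus (P : Measure (ι → C)) [IsFiniteMeasure P] (F : Finset ι) (ε : ℝ≥0∞) : ℝ≥0∞ :=
  F.sup fun α =>
    ∫⁻ y, ⨆ E : ℝ, ProbabilityTheory.condDistrib (fun ω : ι → C => (ω α : ℝ)) (others α) P y
        (openInterval E ε)
      ∂(P.map (others α))

/-- The vector of `ℝ^ι` whose coordinates are `1` on `F` and `0` elsewhere. -/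
def oneF (F : Finset ι) : ι → ℝ := Set.indicator (F : Set ι) 1

/-- `f` only depends on the coordinates in `F`. -/
def DependsOnlyOn (F : Finset ι) (f : (ι → C) → ℝ) : Prop :=
  ∀ ω ω' : ι → C, (∀ α ∈ F, ω α = ω' α) → f ω = f ω'

/-- `f ω - f (ω - t 1_F) ≥ t * c` for all `t ≥ 0` such that both arguments lie in `C^ι`. -/
def DiagIncreasing (F : Finset ι) (c : ℝ) (f : (ι → C) → ℝ) : Prop :=
  ∀ (ω ω' : ι → C) (t : ℝ), 0 ≤ t →
    (fun α => (ω' α : ℝ)) = (fun α => (ω α : ℝ)) - t • oneF F → t * c ≤ f ω - f ω'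

/-- `f ω - f (ω - t 1_F) ≤ - t * c` for all `t ≥ 0` such that both arguments lie in `C^ι`. -/
def DiagDecreasing (F : Finset ι) (c : ℝ) (f : (ι → C) → ℝ) : Prop :=
  ∀ (ω ω' : ι → C) (t : ℝ), 0 ≤ t →
    (fun α => (ω' α : ℝ)) = (fun α => (ω α : ℝ)) - t • oneF F → f ω - f ω' ≤ -(t * c)

/-- The product `C^F`, as a subset of `ℝ^F`. -/
def cube (C : Set ℝ) (F : Finset ι) : Set (F → ℝ) := Set.univ.pi fun _ => C

/-- The function `f`, seen as a function `g` of the coordinates in `F`, is continuous on `C^F` and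
continuously differentiable in the interior. -/
def IsC1Rep (F : Finset ι) (f : (ι → C) → ℝ) (g : (F → ℝ) → ℝ) : Prop :=
  (∀ ω : ι → C, f ω = g fun α => (ω α : ℝ)) ∧ ContinuousOn g (cube C F) ∧
    ContDiffOn ℝ 1 g (interior (cube C F))

open Classical in
/-- The partial derivative of `g` at `x` with respect to the coordinate `α`. -/
def partialDeriv {F : Finset ι} (g : (F → ℝ) → ℝ) (α : F) (x : F → ℝ) : ℝ :=
  fderiv ℝ g x (Pi.single α 1)

/-- `f` is `C^1`, has nonnegative partial derivatives, and their sum over `F` is at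
least `c`. -/
def C1Increasing (F : Finset ι) (c : ℝ) (f : (ι → C) → ℝ) : Prop :=
  ∃ g : (F → ℝ) → ℝ, IsC1Rep F f g ∧ ∀ x ∈ interior (cube C F),
    (∀ α, 0 ≤ partialDeriv g α x) ∧ c ≤ ∑ α, partialDeriv g α x

/-- `f` is `C^1`, has nonpositive partial derivatives, and their sum over `F` is at
most `-c`. -/
def C1Decreasing (F : Finset ι) (c : ℝ) (f : (ι → C) → ℝ) : Prop :=
  ∃ g : (F → ℝ) → ℝ, IsC1Rep F f g ∧ ∀ x ∈ interior (cube C F),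
    (∀ α, partialDeriv g α x ≤ 0) ∧ ∑ α, partialDeriv g α x ≤ -c

end Randomness

end Wegner

end

namespace Wegner

/-! ### Diagonal shifts and conditional concentration -/

section Probability

variable {ι : Type*} {C : Set ℝ}

/-! Each eigenvalue is treated separately. By min-max (`eigenvalue_add_le`), inequalities between
forms pass to the ordered eigenvalues, so each eigenvalue is monotone in the coordinates in `F` and
moves with speed at least `γ` along `oneF F`. A priori different vectors could choose different
directions; `IsForm.not_sub_neg_and_pos` excludes this, because a difference of forms that dominates
`c * ‖w‖ ^ 2` in absolute value cannot change sign.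

If `Φ` increases with speed `γ`, a diagonal shift slightly longer than `(b - a) / γ` carries `{a ≤ Φ
≤ b}` into `{b < Φ}`, as long as it stays in `C^ι`. It remains to bound the probability of entering
an upper set under a shift (`measure_shift_le`). The coordinates in `F` are shifted one at a time:
given all the others, the values of one coordinate that enter lie in a short interval, whose
expected conditional mass is at most `modulus`.

Upper sets need not be measurable, so `exists_measurable_upperSet` replaces them by measurable ones;
arbitrarily short shifts show that the error is null. Finally `posTrace_spectralProj` identifies the
trace with the number of eigenvalues in `I`, and the bounds for the at most `K` relevant indices are
added. -/

theorem oneF_of_mem {S : Finset ι} {α : ι} (h : α ∈ S) : oneF S α = 1 := by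
  simp [oneF, h]

theorem oneF_of_notMem {S : Finset ι} {α : ι} (h : α ∉ S) : oneF S α = 0 := by
  simp [oneF, h]

/-- The set of points that enter an upper set of reals when shifted by `δ` lies in an open interval
of any length larger than `δ`. -/
theorem exists_subset_openInterval {J : Set ℝ} (hJ : IsUpperSet J) {δ : ℝ} {ε : ℝ≥0∞}
    (h : ENNReal.ofReal δ < ε) : ∃ E, {x | x ∉ J ∧ x + δ ∈ J} ⊆ openInterval E ε := by
  obtain ⟨r, hr1, hr2⟩ := ENNReal.lt_iff_exists_nnreal_btwn.1 h
  have hδ : δ < r := by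
    rw [← ENNReal.ofReal_coe_nnreal] at hr1
    by_contra! hle
    exact hr1.not_ge (ENNReal.ofReal_le_ofReal hle)
  set S := {x | x ∉ J ∧ x + δ ∈ J} with hS
  have key : ∀ x ∈ S, ∀ y ∈ S, x < y + δ := fun x hx y hy => by
    by_contra! hxy
    exact hx.1 (hJ hxy hy.2)
  -- `S` spans at most `δ`; the slack `r - δ` makes the left endpoint strict and keeps all distances
  -- at most `r < ε`.
  refine ⟨sInf S - (r - δ), fun x hx => ?_⟩
  have hbdd : BddBelow S := ⟨x - δ, fun y hy => by linarith [key x hx y hy]⟩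
  have h1 : sInf S ≤ x := csInf_le hbdd hx
  have h2 : x - δ ≤ sInf S := le_csInf ⟨x, hx⟩ fun y hy => by linarith [key x hx y hy]
  refine ⟨by linarith, lt_of_le_of_lt (ENNReal.ofReal_le_ofReal ?_) (b := ENNReal.ofReal r) ?_⟩
  · linarith
  · rwa [ENNReal.ofReal_coe_nnreal]

open Classical in
/-- The point with coordinates `p.1` away from `α` and coordinate `p.2` at `α`. -/
noncomputable def join (α : ι) (p : ({β : ι // β ≠ α} → C) × ℝ) : ι → ℝ := fun β =>
  if h : β = α then p.2 else p.1 ⟨β, h⟩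

theorem measurable_join (α : ι) : Measurable (join (C := C) α) := by
  refine measurable_pi_iff.2 fun β => ?_
  by_cases h : β = α
  · simpa [join, h] using measurable_snd
  · simp only [join, h, dite_false]
    fun_prop

theorem join_others (α : ι) (ω : ι → C) : join α (others α ω, (ω α : ℝ)) = fun β => (ω β : ℝ) := by
  funext β
  by_cases h : β = α
  · subst h; simp [join]
  · simp [join, h, others]

theorem join_mono (α : ι) (y : {β : ι // β ≠ α} → C) : Monotone fun x : ℝ => join α (y, x) := by
  intro x x' hx β
  by_cases h : β = α
  · simpa [join, h] using hx
  · simp [join, h]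

theorem join_add_smul_oneF_insert [DecidableEq ι] {α : ι} {S : Finset ι} (hα : α ∉ S)
    (y : {β : ι // β ≠ α} → C) (x δ : ℝ) :
    join α (y, x) + δ • oneF (insert α S) = join α (y, x + δ) + δ • oneF S := by
  funext β
  by_cases h : β = α
  · subst h; simp [join, oneF_of_notMem hα, oneF_of_mem (Finset.mem_insert_self β S)]
  · by_cases hβ : β ∈ S
    · simp [join, h, oneF_of_mem hβ, oneF_of_mem (Finset.mem_insert_of_mem hβ)]
    · simp [join, h, oneF_of_notMem hβ, oneF_of_notMem (show β ∉ insert α S by simp [h, hβ])]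

theorem measurable_others (α : ι) : Measurable (others (C := C) α) := by
  unfold others; fun_prop

/-- A measurable upper set of `ℝ^ι` which is almost as large as a given subset `U` of `C^ι`, and
which contains all the points outside of `C^ι` whose coordinates in `F` are large. -/
theorem exists_measurable_upperSet [Countable ι] (hC : C.OrdConnected) (F : Finset ι) (U : Set (ι → C)) :
    ∃ V : Set (ι → ℝ), IsUpperSet V ∧ MeasurableSet V ∧
      (∀ ω : ι → C, (fun β => (ω β : ℝ)) ∈ V → ∃ ω' ∈ U, ∀ α ∈ F, ω' α ≤ ω α) ∧
      ∀ (ω : ι → C) (δ δ' : ℝ), 0 ≤ δ → δ < δ' →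
        (∀ ω' : ι → C, (fun β => (ω' β : ℝ)) = (fun β => (ω β : ℝ)) + δ • oneF F → ω' ∈ U) →
        (fun β => (ω β : ℝ)) + δ' • oneF F ∈ V := by
  -- The second piece consists of orthants with rational corners above points of `U`, so the union
  -- is countable. The first piece misses `C^ι` and catches the shifts that leave it.
  set V : Set (ι → ℝ) := (⋃ α ∈ F, (fun x => x α) ⁻¹' upperBounds C ∩ (fun x => x α) ⁻¹' Cᶜ) ∪
    ⋃ q : F → ℚ, ⋃ _ : ∃ ω ∈ U, ∀ α : F, (ω α : ℝ) ≤ q α,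
      ⋂ α : F, {x | (q α : ℝ) ≤ x α} with hVdef
  have hmem : ∀ x, x ∈ V ↔ (∃ α ∈ F, x α ∈ upperBounds C ∧ x α ∉ C) ∨
      ∃ q : F → ℚ, (∃ ω ∈ U, ∀ α : F, (ω α : ℝ) ≤ q α) ∧ ∀ α : F, (q α : ℝ) ≤ x α := by
    intro x
    simp only [hVdef, Set.mem_union, Set.mem_iUnion, Set.mem_inter_iff, Set.mem_preimage,
      Set.mem_compl_iff, Set.mem_iInter, Set.mem_ofPred_eq, exists_prop]
  refine ⟨V, ?_, ?_, ?_, ?_⟩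
  · intro x y hxy hx
    rw [hmem] at hx ⊢
    rcases hx with ⟨α, hα, h1, h2⟩ | ⟨q, hq, hqx⟩
    · refine Or.inl ⟨α, hα, fun c hc => (h1 hc).trans (hxy α), fun hy => h2 ?_⟩
      rwa [le_antisymm (hxy α) (h1 hy)]
    · exact Or.inr ⟨q, hq, fun α => (hqx α).trans (hxy α)⟩
  · have hub : IsUpperSet (upperBounds C) := fun a b hab ha c hc => (ha hc).trans hab
    refine MeasurableSet.union ?_ ?_
    · refine Finset.measurableSet_biUnion _ fun α _ => ?_
      exact ((measurable_pi_apply α) hub.ordConnected.measurableSet).inter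
        ((measurable_pi_apply α) hC.measurableSet.compl)
    · refine MeasurableSet.iUnion fun q => MeasurableSet.iUnion fun _ =>
        MeasurableSet.iInter fun α => ?_
      exact measurableSet_le measurable_const (measurable_pi_apply _)
  · intro ω hω
    rcases (hmem _).1 hω with ⟨α, hα, h1, h2⟩ | ⟨q, ⟨ω', hω', h1⟩, h2⟩
    · exact absurd (ω α).2 h2
    · exact ⟨ω', hω', fun α hα => (h1 ⟨α, hα⟩).trans (h2 ⟨α, hα⟩)⟩
  · intro ω δ δ' hδ0 hδ hU
    rw [hmem]
    by_cases hcase : ∀ α ∈ F, (ω α : ℝ) + δ ∈ C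
    · right
      classical
      let ω' : ι → C := fun α => if h : α ∈ F then ⟨ω α + δ, hcase α h⟩ else ω α
      have hω' : ω' ∈ U := hU ω' (by
        funext α
        by_cases h : α ∈ F
        · simp [ω', h, oneF_of_mem h]
        · simp [ω', h, oneF_of_notMem h])
      choose q hq1 hq2 using fun α : F =>
        exists_rat_btwn (show (ω α : ℝ) + δ < ω α + δ' by linarith)
      refine ⟨q, ⟨ω', hω', fun α => ?_⟩, fun α => ?_⟩
      · simpa [ω', α.2] using (hq1 α).le
      · simpa [oneF_of_mem α.2] using (hq2 α).le
    · left
      push Not at hcase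
      obtain ⟨α, hα, hc⟩ := hcase
      -- `C` is an interval that contains `ω α` but not the larger number `ω α + δ`, so it lies
      -- entirely below the latter.
      have hbd : ∀ c ∈ C, c < ω α + δ := fun c hcC => by
        by_contra! hle
        exact hc (hC.out (ω α).2 hcC ⟨by linarith, hle⟩)
      refine ⟨α, hα, ?_, ?_⟩
      · intro c hcC
        simpa [oneF_of_mem hα] using (hbd c hcC).le.trans (by linarith)
      · intro hcC
        have := hbd _ hcC
        simp [oneF_of_mem hα] at this
        linarith

variable (P : Measure (ι → C)) [IsProbabilityMeasure P]

/-- The expected concentration of the coordinate `α` on open intervals of length `ε`. -/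
noncomputable def concentration (α : ι) (ε : ℝ≥0∞) : ℝ≥0∞ :=
  ∫⁻ y, ⨆ E : ℝ, ProbabilityTheory.condDistrib (fun ω : ι → C => (ω α : ℝ)) (others α) P y
    (openInterval E ε) ∂(P.map (others α))

theorem concentration_le_modulus {F : Finset ι} {α : ι} (hα : α ∈ F) (ε : ℝ≥0∞) :
    concentration P α ε ≤ modulus P F ε :=
  Finset.le_sup (f := fun α => concentration P α ε) hα

variable [Countable ι]

/-- Disintegrate over the coordinates other than `α`. In each fibre, membership in `V` defines an
upper set of reals, and the event says that `ω α` enters it when shifted by `δ`. -/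
theorem measure_shift_insert_le [DecidableEq ι] {V : Set (ι → ℝ)} (hV : IsUpperSet V)
    (hVm : MeasurableSet V) {δ : ℝ} {ε : ℝ≥0∞} (hδ : ENNReal.ofReal δ < ε) {α : ι} {S : Finset ι}
    (hα : α ∉ S) :
    P {ω | (fun β => (ω β : ℝ)) + δ • oneF S ∉ V ∧
        (fun β => (ω β : ℝ)) + δ • oneF (insert α S) ∈ V} ≤ concentration P α ε := by
  set B : Set (({β : ι // β ≠ α} → C) × ℝ) :=
    {p | join α p + δ • oneF S ∉ V ∧ join α p + δ • oneF (insert α S) ∈ V} with hB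
  have hBm : MeasurableSet B :=
    (((measurable_join α).add_const _) hVm.compl).inter (((measurable_join α).add_const _) hVm)
  have hmeas : Measurable fun ω : ι → C => (ω α : ℝ) := by fun_prop
  have hset : {ω : ι → C | (fun β => (ω β : ℝ)) + δ • oneF S ∉ V ∧
      (fun β => (ω β : ℝ)) + δ • oneF (insert α S) ∈ V} =
      (fun ω => (others α ω, (ω α : ℝ))) ⁻¹' B := by
    ext ω
    simp [hB, join_others]
  rw [hset, ← Measure.map_apply ((measurable_others α).prodMk hmeas) hBm,
    ← ProbabilityTheory.compProd_map_condDistrib hmeas.aemeasurable, Measure.compProd_apply hBm]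
  refine lintegral_mono fun y => ?_
  obtain ⟨E, hE⟩ := exists_subset_openInterval
    (J := {x | join α (y, x) + δ • oneF S ∈ V}) (fun x x' hx h =>
      hV (add_le_add_left (join_mono α y hx) _) h) hδ
  refine le_iSup_of_le E (measure_mono ?_)
  refine Set.Subset.trans (fun x hx => ?_) hE
  obtain ⟨h1, h2⟩ := hx
  rw [join_add_smul_oneF_insert hα] at h2
  exact ⟨h1, h2⟩

/-- Telescoping: a point that enters `V` under the full shift does so at one of the successive
coordinate shifts. -/
theorem measure_shift_le_sum {V : Set (ι → ℝ)} (hV : IsUpperSet V)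
    (hVm : MeasurableSet V) {δ : ℝ} {ε : ℝ≥0∞} (hδ : ENNReal.ofReal δ < ε) (S : Finset ι) :
    P {ω | (fun β => (ω β : ℝ)) ∉ V ∧ (fun β => (ω β : ℝ)) + δ • oneF S ∈ V} ≤
      ∑ α ∈ S, concentration P α ε := by
  classical
  induction S using Finset.induction_on with
  | empty =>
    have : oneF (∅ : Finset ι) = 0 := by funext β; simp [oneF]
    simp [this]
  | insert α S hα ih =>
    rw [Finset.sum_insert hα, add_comm]
    refine le_trans (measure_mono ?_) ((measure_union_le _ _).trans
      (add_le_add ih (measure_shift_insert_le P hV hVm hδ hα)))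
    intro ω hω
    by_cases h : (fun β => (ω β : ℝ)) + δ • oneF S ∈ V
    · exact Or.inl ⟨hω.1, h⟩
    · exact Or.inr ⟨h, hω.2⟩

theorem measure_shift_le {V : Set (ι → ℝ)} (hV : IsUpperSet V)
    (hVm : MeasurableSet V) {δ : ℝ} {ε : ℝ≥0∞} (hδ : ENNReal.ofReal δ < ε) (F : Finset ι) :
    P {ω | (fun β => (ω β : ℝ)) ∉ V ∧ (fun β => (ω β : ℝ)) + δ • oneF F ∈ V} ≤
      F.card * modulus P F ε := by
  refine (measure_shift_le_sum P hV hVm hδ F).trans ?_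
  refine (Finset.sum_le_card_nsmul _ _ _ fun α hα => concentration_le_modulus P hα ε).trans ?_
  rw [nsmul_eq_mul]

end Probability

/-! ### Measurability and concentration of monotone functions -/

section Concentration

variable {ι : Type*} {C : Set ℝ} {P : Measure (ι → C)} [IsProbabilityMeasure P]
  {F : Finset ι}

/-- This is how the decay of `modulus` at zero enters: a bound available for all small shifts forces
a null set. -/
theorem measure_eq_zero_of_le_modulus (hP : Tendsto (modulus P F) (𝓝[>] 0) (𝓝 0))
    {A : Set (ι → C)} (hA : ∀ δ : ℝ, 0 < δ → ∀ ε, ENNReal.ofReal δ < ε →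
      P A ≤ F.card * modulus P F ε) : P A = 0 := by
  have h1 : Tendsto (fun ε => (F.card : ℝ≥0∞) * modulus P F ε) (𝓝[>] 0) (𝓝 0) := by
    simpa using ENNReal.Tendsto.const_mul hP (Or.inr (ENNReal.natCast_ne_top F.card))
  refine le_antisymm (ge_of_tendsto h1 ?_) zero_le
  filter_upwards [self_mem_nhdsWithin] with ε hε
  obtain ⟨r, hr1, hr2⟩ := ENNReal.lt_iff_exists_nnreal_btwn.1 (Set.mem_Ioi.1 hε)
  exact hA r (by exact_mod_cast hr1) ε (by rwa [ENNReal.ofReal_coe_nnreal])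

variable [Countable ι]

/-- The measurable set `W` lies inside `U`, and every point of `U \ W` enters `V` under each
positive shift, however short; hence `U \ W` is null. -/
theorem nullMeasurableSet_of_upper (hC : C.OrdConnected)
    (hP : Tendsto (modulus P F) (𝓝[>] 0) (𝓝 0)) {U : Set (ι → C)}
    (hU : ∀ ω ω' : ι → C, ω ∈ U → (∀ α ∈ F, ω α ≤ ω' α) → ω' ∈ U) : NullMeasurableSet U P := by
  obtain ⟨V, hV, hVm, hVU, hUV⟩ := exists_measurable_upperSet hC F U
  set W : Set (ι → C) := (fun ω β => (ω β : ℝ)) ⁻¹' V with hW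
  have hWm : MeasurableSet W := by
    have : Measurable fun (ω : ι → C) (β : ι) => (ω β : ℝ) := by fun_prop
    exact this hVm
  have hWU : W ⊆ U := fun ω hω => by
    obtain ⟨ω', h1, h2⟩ := hVU ω hω
    exact hU ω' ω h1 h2
  have hnull : P (U \ W) = 0 := by
    refine measure_eq_zero_of_le_modulus hP fun δ hδ ε hε => ?_
    refine le_trans (measure_mono ?_) (measure_shift_le P hV hVm hε F)
    refine fun ω hω => ⟨hω.2, ?_⟩
    refine hUV ω 0 δ le_rfl hδ fun ω' hω' => ?_
    have : ω' = ω := by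
      funext β
      exact Subtype.ext (by simpa using congrFun hω' β)
    rw [this]
    exact hω.1
  rw [← Set.union_sdiff_cancel hWU]
  exact hWm.nullMeasurableSet.union (NullMeasurableSet.of_null hnull)

/-- If the conditional distributions spread out, the coordinates in `F` take several values. -/
theorem exists_lt_of_tendsto_modulus (hP : Tendsto (modulus P F) (𝓝[>] 0) (𝓝 0))
    (hF : F.Nonempty) : ∃ a ∈ C, ∃ b ∈ C, a < b := by
  by_contra! hsub
  obtain ⟨α, hα⟩ := hF
  have : (Set.univ : Set (ι → C)).Nonempty := by
    by_contra hne
    have h1 := measure_univ (μ := P)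
    rw [Set.not_nonempty_iff_eq_empty.1 hne, measure_empty] at h1
    exact zero_ne_one h1
  obtain ⟨ω₀, -⟩ := this
  -- If `C` were a single point, every `ω` would enter this half-space under every positive shift,
  -- so the whole space would be null.
  have hV : IsUpperSet {x : ι → ℝ | (ω₀ α : ℝ) < x α} := fun x y hxy hx =>
    lt_of_lt_of_le hx (hxy α)
  have hVm : MeasurableSet {x : ι → ℝ | (ω₀ α : ℝ) < x α} :=
    measurableSet_lt measurable_const (measurable_pi_apply α)
  have h0 : P Set.univ = 0 := by
    refine measure_eq_zero_of_le_modulus hP fun δ hδ ε hε => ?_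
    refine le_trans (measure_mono ?_) (measure_shift_le P hV hVm hε F)
    refine fun ω _ => ⟨?_, ?_⟩
    · exact not_lt.2 (hsub _ (ω₀ α).2 _ (ω α).2)
    · have := hsub _ (ω α).2 _ (ω₀ α).2
      simp only [Set.mem_ofPred_eq, Pi.add_apply, Pi.smul_apply, oneF_of_mem hα, smul_eq_mul,
        mul_one]
      linarith
  simp at h0

theorem nullMeasurable_of_monotoneOn (hC : C.OrdConnected)
    (hP : Tendsto (modulus P F) (𝓝[>] 0) (𝓝 0)) {Φ : (ι → C) → ℝ}
    (hΦ : ∀ ω ω' : ι → C, (∀ α ∈ F, ω α ≤ ω' α) → Φ ω ≤ Φ ω') : NullMeasurable Φ P := by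
  refine measurable_of_Ioi (mδ := NullMeasurableSpace.instMeasurableSpace (μ := P)) fun b => ?_
  exact nullMeasurableSet_of_upper hC hP fun ω ω' hω h => lt_of_lt_of_le hω (hΦ ω ω' h)

theorem measure_preimage_Icc_le (hC : C.OrdConnected) {γ : ℝ} (hγ : 0 < γ) {Φ : (ι → C) → ℝ}
    (hΦ : ∀ ω ω' : ι → C, (∀ α ∈ F, ω α ≤ ω' α) → Φ ω ≤ Φ ω') (hdiag : DiagIncreasing F γ Φ)
    {a b : ℝ} (hab : a ≤ b) {ε : ℝ≥0∞} (hε : ENNReal.ofReal ((b - a) / γ) < ε) :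
    P (Φ ⁻¹' Set.Icc a b) ≤ F.card * modulus P F ε := by
  obtain ⟨V, hV, hVm, hVU, hUV⟩ := exists_measurable_upperSet hC F {ω | b < Φ ω}
  obtain ⟨r, hr1, hr2⟩ := ENNReal.lt_iff_exists_nnreal_btwn.1 hε
  have hr : (b - a) / γ < r := by
    rw [← ENNReal.ofReal_coe_nnreal] at hr1
    by_contra! hle
    exact hr1.not_ge (ENNReal.ofReal_le_ofReal hle)
  have h0 : 0 ≤ (b - a) / γ := div_nonneg (by linarith) hγ.le
  -- Shifting by `δ` already pushes `Φ` above `b`; the set `V` is only guaranteed to contain the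
  -- point after the longer shift `r`.
  obtain ⟨δ, hδ1, hδ2⟩ := exists_between hr
  refine le_trans (measure_mono ?_)
    (measure_shift_le P hV hVm (δ := r) (by rwa [ENNReal.ofReal_coe_nnreal]) F)
  refine fun ω hω => ⟨fun hωV => ?_, ?_⟩
  · obtain ⟨ω', h1, h2⟩ := hVU ω hωV
    exact absurd (h1.trans_le (hΦ ω' ω h2)) (not_lt.2 hω.2)
  · refine hUV ω δ r (h0.trans hδ1.le) hδ2 fun ω' hω' => ?_
    have h1 := hdiag ω' ω δ (h0.trans hδ1.le) (by rw [hω']; simp)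
    have h2 : b - a < δ * γ := (div_lt_iff₀ hγ).1 hδ1
    have h3 : a ≤ Φ ω := hω.1
    exact show b < Φ ω' by linarith

/-- A function that increases in the coordinates in `F`, with speed at least `γ` along the
diagonal, lies in an open interval `I` with probability at most `|F| s_F(P, |I| / γ)`. -/
theorem measure_preimage_le_of_diagIncreasing (hC : C.OrdConnected)
    (hP : Tendsto (modulus P F) (𝓝[>] 0) (𝓝 0)) {γ : ℝ} (hγ : 0 < γ) {Φ : (ι → C) → ℝ}
    (hΦ : ∀ ω ω' : ι → C, (∀ α ∈ F, ω α ≤ ω' α) → Φ ω ≤ Φ ω') (hdiag : DiagIncreasing F γ Φ)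
    {I : Set ℝ} (hIopen : IsOpen I) (hI : I.OrdConnected) :
    P (Φ ⁻¹' I) ≤ F.card * modulus P F (volume I / ENNReal.ofReal γ) := by
  have hm : AEMeasurable Φ P := (nullMeasurable_of_monotoneOn hC hP hΦ).aemeasurable
  -- The estimate on closed intervals needs strict room in `ε`. A compact subset of the open `I` has
  -- a strictly shorter hull, so inner regularity reaches `ε = |I| / γ` itself, also when `|I|` is
  -- infinite.
  rw [← Measure.map_apply_of_aemeasurable hm hIopen.measurableSet,
    hIopen.measure_eq_iSup_isCompact (P.map Φ)]
  refine iSup_le fun k => iSup_le fun hkI => iSup_le fun hk => ?_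
  rcases k.eq_empty_or_nonempty with rfl | hne
  · simp
  have ha := hkI (hk.sInf_mem hne)
  have hb := hkI (hk.sSup_mem hne)
  have hab : sInf k ≤ sSup k := csInf_le_csSup hne hk.bddBelow hk.bddAbove
  have hsub : k ⊆ Set.Icc (sInf k) (sSup k) := fun x hx =>
    ⟨csInf_le hk.bddBelow hx, le_csSup hk.bddAbove hx⟩
  refine (measure_mono hsub).trans ?_
  rw [Measure.map_apply_of_aemeasurable hm measurableSet_Icc]
  refine measure_preimage_Icc_le hC hγ hΦ hdiag hab ?_
  obtain ⟨b', hb', hb'I⟩ : ∃ b' > sSup k, Set.Icc (sSup k) b' ⊆ I := by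
    obtain ⟨v, hv, hv'⟩ := (mem_nhdsGE_iff_exists_Icc_subset (a := sSup k)).1
      (mem_nhdsWithin_of_mem_nhds (hIopen.mem_nhds hb))
    exact ⟨v, hv, hv'⟩
  have hvol : ENNReal.ofReal (sSup k - sInf k) < volume I := by
    refine lt_of_lt_of_le ?_ (measure_mono (hI.out ha (hb'I (Set.right_mem_Icc.2 hb'.le))))
    rw [Real.volume_Icc]
    exact (ENNReal.ofReal_lt_ofReal_iff (by linarith)).2 (by linarith)
  rw [ENNReal.ofReal_div_of_pos hγ]
  exact ENNReal.div_lt_div_right (ENNReal.ofReal_pos.2 hγ).ne' ENNReal.ofReal_ne_top hvol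

end Concentration

/-! ### From derivative bounds to monotonicity -/

section Smooth

variable {ι : Type*} {C : Set ℝ} {F : Finset ι}

/-- The segment from `x` to `y` may run in the boundary of the cube, where `g` is only continuous.
It is contracted towards an interior point `c` by a factor `1 - s`, the mean value inequality is
applied there, and `s` tends to zero. -/
theorem le_sub_of_le_fderiv (hC : C.OrdConnected) {a b : ℝ} (ha : a ∈ C) (hb : b ∈ C) (hab : a < b)
    {g : (F → ℝ) → ℝ} (hg : ContinuousOn g (cube C F)) (hg' : ContDiffOn ℝ 1 g (interior (cube C F)))
    {x y : F → ℝ} (hx : x ∈ cube C F) (hy : y ∈ cube C F) {κ : ℝ}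
    (hκ : ∀ z ∈ interior (cube C F), κ ≤ fderiv ℝ g z (y - x)) : κ ≤ g y - g x := by
  have hconv : Convex ℝ (cube C F) := convex_pi fun _ _ => hC.convex
  set c : F → ℝ := fun _ => (a + b) / 2
  have hc : c ∈ interior (cube C F) := by
    rw [cube, interior_pi_set Set.finite_univ]
    refine fun _ _ => interior_maximal (Set.Ioo_subset_Icc_self.trans (hC.out ha hb)) isOpen_Ioo ?_
    constructor <;> simp only [c] <;> linarith
  set z : ℝ → ℝ → F → ℝ := fun s r => (1 - s) • (x + r • (y - x)) + s • c with hz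
  have hzint : ∀ s, 0 < s → s ≤ 1 → ∀ r ∈ Set.Icc (0 : ℝ) 1, z s r ∈ interior (cube C F) :=
    fun s hs hs1 r hr => hconv.combo_self_interior_mem_interior
      (hconv.add_smul_sub_mem hx hy hr) hc (by linarith) hs (by ring)
  have hstep : ∀ s, 0 < s → s ≤ 1 → (1 - s) * κ ≤ g (z s 1) - g (z s 0) := by
    intro s hs hs1
    have hder : ∀ r ∈ Set.Icc (0 : ℝ) 1,
        HasDerivAt (fun r => g (z s r)) (fderiv ℝ g (z s r) ((1 - s) • (y - x))) r := by
      intro r hr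
      have h1 : HasDerivAt (z s) ((1 - s) • (y - x)) r := by
        have := ((((hasDerivAt_id r).smul_const (y - x)).const_add x).const_smul (1 - s)).add_const
          (s • c)
        simpa [hz] using this
      have h2 : DifferentiableAt ℝ g (z s r) :=
        (hg'.differentiableOn one_ne_zero).differentiableAt
          (isOpen_interior.mem_nhds (hzint s hs hs1 r hr))
      exact h2.hasFDerivAt.comp_hasDerivAt r h1
    have := (convex_Icc (0 : ℝ) 1).mul_sub_le_image_sub_of_le_deriv (f := fun r => g (z s r))
      (fun r hr => (hder r hr).continuousAt.continuousWithinAt)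
      (fun r hr => (hder r (interior_subset hr)).differentiableAt.differentiableWithinAt)
      (C := (1 - s) * κ) (fun r hr => by
        have hr' := interior_subset hr
        rw [(hder r hr').deriv, map_smul, smul_eq_mul]
        exact mul_le_mul_of_nonneg_left (hκ _ (hzint s hs hs1 r hr')) (by linarith))
      0 (by simp) 1 (by simp) zero_le_one
    simpa using this
  have hlim : ∀ r ∈ Set.Icc (0 : ℝ) 1,
      Tendsto (fun s => g (z s r)) (𝓝[>] 0) (𝓝 (g (x + r • (y - x)))) := by
    intro r hr
    refine (hg _ (hconv.add_smul_sub_mem hx hy hr)).tendsto.comp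
      (tendsto_nhdsWithin_iff.2 ⟨?_, ?_⟩)
    · have : Continuous fun s => z s r := by fun_prop
      have h := this.tendsto 0
      simp only [hz, sub_zero, one_smul, zero_smul, add_zero] at h
      exact h.mono_left nhdsWithin_le_nhds
    · filter_upwards [Ioc_mem_nhdsGT (zero_lt_one' ℝ)] with s hs
      exact interior_subset (hzint s hs.1 hs.2 r hr)
  have hl : Tendsto (fun s : ℝ => (1 - s) * κ) (𝓝[>] 0) (𝓝 κ) := by
    have : Continuous fun s : ℝ => (1 - s) * κ := by fun_prop
    have h := this.tendsto 0
    simp only [sub_zero, one_mul] at h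
    exact h.mono_left nhdsWithin_le_nhds
  have h10 := (hlim 1 (by simp)).sub (hlim 0 (by simp))
  simp only [one_smul, zero_smul, add_zero, add_sub_cancel] at h10
  refine le_of_tendsto_of_tendsto hl h10 ?_
  filter_upwards [Ioc_mem_nhdsGT (zero_lt_one' ℝ)] with s hs
  exact hstep s hs.1 hs.2

theorem fderiv_apply_eq_sum_partialDeriv (g : (F → ℝ) → ℝ) (z v : F → ℝ) :
    fderiv ℝ g z v = ∑ α, v α * partialDeriv g α z := by
  classical
  have h := LinearMap.pi_apply_eq_sum_univ (fderiv ℝ g z).toLinearMap v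
  simp only [ContinuousLinearMap.coe_coe, smul_eq_mul] at h
  rw [h]
  refine Finset.sum_congr rfl fun α _ => ?_
  unfold partialDeriv
  congr 2
  funext β
  simp [Pi.single_apply, eq_comm]

theorem C1Increasing.monotone_and_diagIncreasing (hC : C.OrdConnected) {a b : ℝ} (ha : a ∈ C)
    (hb : b ∈ C) (hab : a < b) {c : ℝ} {f : (ι → C) → ℝ} (hf : C1Increasing F c f) :
    Monotone f ∧ DiagIncreasing F c f := by
  obtain ⟨g, ⟨hfg, hg, hg'⟩, hpos⟩ := hf
  have hmem : ∀ ω : ι → C, (fun α : F => (ω α : ℝ)) ∈ cube C F := fun ω α _ => (ω α).2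
  constructor
  · intro ω ω' hω
    rw [hfg, hfg, ← sub_nonneg]
    refine le_sub_of_le_fderiv hC ha hb hab hg hg' (hmem ω) (hmem ω') fun z hz => ?_
    rw [fderiv_apply_eq_sum_partialDeriv]
    exact Finset.sum_nonneg fun α _ => mul_nonneg (sub_nonneg.2 (hω α)) ((hpos z hz).1 α)
  · intro ω ω' t ht hω
    rw [hfg, hfg]
    refine le_sub_of_le_fderiv hC ha hb hab hg hg' (hmem ω') (hmem ω) fun z hz => ?_
    have hv : ((fun α : F => (ω α : ℝ)) - fun α : F => (ω' α : ℝ)) = fun _ => t := by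
      funext α
      have := congrFun hω α
      simp only [Pi.sub_apply, Pi.smul_apply, oneF_of_mem α.2, smul_eq_mul, mul_one] at this ⊢
      linarith
    rw [fderiv_apply_eq_sum_partialDeriv, hv, ← Finset.mul_sum]
    exact mul_le_mul_of_nonneg_left (hpos z hz).2 ht

theorem C1Decreasing.neg {c : ℝ} {f : (ι → C) → ℝ} (hf : C1Decreasing F c f) :
    C1Increasing F c (-f) := by
  obtain ⟨g, ⟨hfg, hg, hg'⟩, hneg⟩ := hf
  have hpd : ∀ α z, partialDeriv (-g) α z = -partialDeriv g α z := fun α z => by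
    simp [partialDeriv, fderiv_neg]
  refine ⟨-g, ⟨fun ω => by simp [hfg], hg.neg, hg'.neg⟩, fun z hz => ⟨fun α => ?_, ?_⟩⟩
  · rw [hpd]
    exact neg_nonneg.2 ((hneg z hz).1 α)
  · simp only [hpd, Finset.sum_neg_distrib]
    linarith [(hneg z hz).2]

theorem diagDecreasing_iff_neg {c : ℝ} {f : (ι → C) → ℝ} :
    DiagDecreasing F c f ↔ DiagIncreasing F c (-f) := by
  refine forall₅_congr fun ω ω' t _ _ => ?_
  simp only [Pi.neg_apply]
  constructor <;> intro h <;> linarith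

theorem C1Decreasing.antitone_and_diagDecreasing (hC : C.OrdConnected) {a b : ℝ} (ha : a ∈ C)
    (hb : b ∈ C) (hab : a < b) {c : ℝ} {f : (ι → C) → ℝ} (hf : C1Decreasing F c f) :
    Antitone f ∧ DiagDecreasing F c f := by
  obtain ⟨h1, h2⟩ := hf.neg.monotone_and_diagIncreasing hC ha hb hab
  exact ⟨by simpa using h1.neg, diagDecreasing_iff_neg.2 h2⟩

end Smooth

/-! ### Quadratic forms on operator and form domains -/

section Forms

variable {𝕜 E : Type*} [RCLike 𝕜] [NormedAddCommGroup E] [InnerProductSpace 𝕜 E]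
  {T : E →ₗ.[𝕜] E}

theorem quad_zero : quad T 0 = 0 := by
  simp [quad]

/-- Writing the cross term by polarization involves only values of `quad`, so the identity survives
the passage to the closed form. -/
theorem quad_smul_add_smul (x y : ℝ) (u v : T.domain) :
    quad T ((x : 𝕜) • u + (y : 𝕜) • v) =
      x ^ 2 * quad T u + y ^ 2 * quad T v + x * y * (quad T (u + v) - quad T u - quad T v) := by
  simp only [quad, LinearPMap.map_add, LinearPMap.map_smul, Submodule.coe_add, Submodule.coe_smul,
    inner_add_left, inner_add_right, inner_smul_left, inner_smul_right, RCLike.conj_ofReal,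
    map_add, RCLike.re_ofReal_mul]
  ring

theorem FormApprox.const (u : T.domain) : FormApprox T (fun _ => u) u :=
  ⟨tendsto_const_nhds, by simp [quad_zero]⟩

theorem FormApprox.tendsto_norm_sub {v : ℕ → T.domain} {u : E} (hv : FormApprox T v u) :
    Tendsto (fun p : ℕ × ℕ => ((v p.1 - v p.2 : T.domain) : E)) atTop (𝓝 0) := by
  rw [← prod_atTop_atTop_eq]
  simpa using (hv.1.comp tendsto_fst).sub (hv.1.comp tendsto_snd)

theorem FormApprox.smul_add_smul (hbdd : BoundedBelow T) {v w : ℕ → T.domain} {u u' : E}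
    (hv : FormApprox T v u) (hw : FormApprox T w u') (x y : ℝ) :
    FormApprox T (fun n => (x : 𝕜) • v n + (y : 𝕜) • w n) ((x : 𝕜) • u + (y : 𝕜) • u') := by
  obtain ⟨c, hc⟩ := hbdd
  refine ⟨by simpa using (hv.1.const_smul (x : 𝕜)).add (hw.1.const_smul (y : 𝕜)), ?_⟩
  set d : ℕ × ℕ → T.domain := fun p => v p.1 - v p.2 with hd
  set e : ℕ × ℕ → T.domain := fun p => w p.1 - w p.2 with he
  have heq : ∀ p : ℕ × ℕ, (x : 𝕜) • v p.1 + (y : 𝕜) • w p.1 - ((x : 𝕜) • v p.2 + (y : 𝕜) • w p.2) =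
      (x : 𝕜) • d p + (y : 𝕜) • e p := fun p => by
    simp only [hd, he, smul_sub]; abel
  simp only [heq]
  have hnorm : ∀ y : ℝ, Tendsto
      (fun p => c * ‖(((x : 𝕜) • d p + (y : 𝕜) • e p : T.domain) : E)‖ ^ 2) atTop (𝓝 0) := by
    intro y
    have h := (hv.tendsto_norm_sub.const_smul (x : 𝕜)).add (hw.tendsto_norm_sub.const_smul (y : 𝕜))
    have h2 := ((h.norm).pow 2).const_mul c
    simpa [hd, he] using h2
  -- Parallelogram law: `quad` of the sum plus `quad` of the difference is twice the sum of the two.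
  -- Semiboundedness bounds the difference term from below by a quantity that vanishes in the limit.
  have hupper : ∀ p, quad T ((x : 𝕜) • d p + (y : 𝕜) • e p) ≤
      2 * x ^ 2 * quad T (d p) + 2 * y ^ 2 * quad T (e p) -
        c * ‖(((x : 𝕜) • d p + ((-y : ℝ) : 𝕜) • e p : T.domain) : E)‖ ^ 2 := by
    intro p
    have h1 := hc ((x : 𝕜) • d p + ((-y : ℝ) : 𝕜) • e p)
    rw [quad_smul_add_smul] at h1
    rw [quad_smul_add_smul]
    linarith
  have hlim : Tendsto (fun p => 2 * x ^ 2 * quad T (d p) + 2 * y ^ 2 * quad T (e p) -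
        c * ‖(((x : 𝕜) • d p + ((-y : ℝ) : 𝕜) • e p : T.domain) : E)‖ ^ 2) atTop (𝓝 0) := by
    simpa using ((hv.2.const_mul (2 * x ^ 2)).add (hw.2.const_mul (2 * y ^ 2))).sub (hnorm (-y))
  exact tendsto_of_tendsto_of_tendsto_of_le_of_le (hnorm y) hlim (fun p => hc _) hupper

variable {D : Set E} {h : E → ℝ}

/-- `h` is the quadratic form of `T`, on the operator domain or on the form domain. -/
def IsForm (T : E →ₗ.[𝕜] E) (D : Set E) (h : E → ℝ) : Prop :=
  IsOperatorForm T D h ∨ IsAssociatedForm T D h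

theorem IsForm.mem (hh : IsForm T D h) (u : T.domain) : (u : E) ∈ D := by
  rcases hh with hh | hh
  · rw [hh.1]; exact u.2
  · rw [hh.1]; exact ⟨_, FormApprox.const u⟩

theorem IsForm.apply_eq (hh : IsForm T D h) (u : T.domain) : h u = quad T u := by
  rcases hh with hh | hh
  · exact hh.2 u
  · exact (tendsto_nhds_unique (hh.2 u _ (FormApprox.const u)) tendsto_const_nhds)

theorem IsForm.exists_tendsto (hh : IsForm T D h) {u : E} (hu : u ∈ D) :
    ∃ v : ℕ → T.domain, Tendsto (fun n => (v n : E)) atTop (𝓝 u) ∧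
      Tendsto (fun n => quad T (v n)) atTop (𝓝 (h u)) := by
  rcases hh with hh | hh
  · rw [hh.1] at hu
    exact ⟨fun _ => ⟨u, hu⟩, tendsto_const_nhds, by
      simpa only [← hh.2 ⟨u, hu⟩] using tendsto_const_nhds⟩
  · obtain ⟨v, hv⟩ := hh.1 ▸ hu
    exact ⟨v, hv.1, hh.2 u v hv⟩

theorem IsForm.smul_add_smul (hbdd : BoundedBelow T) (hh : IsForm T D h) {u v : E} (hu : u ∈ D)
    (hv : v ∈ D) (x y : ℝ) : (x : 𝕜) • u + (y : 𝕜) • v ∈ D ∧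
      h ((x : 𝕜) • u + (y : 𝕜) • v) =
        x ^ 2 * h u + y ^ 2 * h v + x * y * (h (u + v) - h u - h v) := by
  rcases hh with hh | hh
  · rw [hh.1] at hu hv ⊢
    lift u to T.domain using hu
    lift v to T.domain using hv
    refine ⟨((x : 𝕜) • u + (y : 𝕜) • v).2, ?_⟩
    have h1 := hh.2 ((x : 𝕜) • u + (y : 𝕜) • v)
    have h2 := hh.2 (u + v)
    simp only [Submodule.coe_add, Submodule.coe_smul] at h1 h2
    rw [h1, h2, hh.2, hh.2, quad_smul_add_smul]
  · obtain ⟨a, ha⟩ := hh.1 ▸ hu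
    obtain ⟨b, hb⟩ := hh.1 ▸ hv
    have hab := ha.smul_add_smul hbdd hb x y
    refine ⟨by rw [hh.1]; exact ⟨_, hab⟩, ?_⟩
    have h1 := hh.2 _ _ (ha.smul_add_smul hbdd hb 1 1)
    simp only [RCLike.ofReal_one, one_smul] at h1
    refine tendsto_nhds_unique (hh.2 _ _ hab) ?_
    simp only [quad_smul_add_smul x y]
    exact (((hh.2 _ _ ha).const_mul _).add ((hh.2 _ _ hb).const_mul _)).add
      (((h1.sub (hh.2 _ _ ha)).sub (hh.2 _ _ hb)).const_mul _)

end Forms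

/-! ### Min-max comparison and the spectral trace -/

section Eigenbasis

variable {𝕜 E : Type*} [RCLike 𝕜] [NormedAddCommGroup E] [InnerProductSpace 𝕜 E]
  {T : E →ₗ.[𝕜] E} {κ : Type*} {b : HilbertBasis κ 𝕜 E} {l : κ → ℝ}

/-- `b` is a Hilbert basis of eigenvectors of `T` with eigenvalues `l`. -/
def IsEigenbasis (T : E →ₗ.[𝕜] E) (b : HilbertBasis κ 𝕜 E) (l : κ → ℝ) : Prop :=
  ∀ n, ∃ h : b n ∈ T.domain, T ⟨b n, h⟩ = (l n : 𝕜) • b n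

theorem hasSum_norm_inner_sq (b : HilbertBasis κ 𝕜 E) (u : E) :
    HasSum (fun k => ‖inner 𝕜 (b k) u‖ ^ 2) (‖u‖ ^ 2) := by
  have h := RCLike.hasSum_re 𝕜 (b.hasSum_inner_mul_inner u u)
  rw [← norm_sq_eq_re_inner] at h
  refine h.congr_fun fun k => ?_
  rw [← inner_conj_symm (b k) u, RCLike.mul_conj, RCLike.norm_conj]
  norm_cast

variable [CompleteSpace E]

theorem inner_apply_comm_of_isSelfAdjoint (hT : IsSelfAdjoint T) (x y : T.domain) :
    inner 𝕜 (T x) (y : E) = inner 𝕜 (x : E) (T y) := by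
  have h := LinearPMap.adjoint_isFormalAdjoint hT.dense_domain
  rw [LinearPMap.isSelfAdjoint_def.1 hT] at h
  exact h x y

theorem hasSum_quad (hT : IsSelfAdjoint T) (hb : IsEigenbasis T b l) (u : T.domain) :
    HasSum (fun k => l k * ‖inner 𝕜 (b k) (u : E)‖ ^ 2) (quad T u) := by
  have h := RCLike.hasSum_re 𝕜 (b.hasSum_inner_mul_inner (T u) u)
  refine h.congr_fun fun k => ?_
  obtain ⟨hk, hTk⟩ := hb k
  have h1 := inner_apply_comm_of_isSelfAdjoint hT u ⟨b k, hk⟩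
  simp only [hTk, inner_smul_right] at h1
  rw [h1, mul_assoc, RCLike.re_ofReal_mul, ← inner_conj_symm (b k) (u : E), RCLike.mul_conj,
    RCLike.norm_conj]
  norm_cast

theorem IsForm.le_apply (hT : IsSelfAdjoint T) (hb : IsEigenbasis T b l) {D : Set E} {h : E → ℝ}
    (hh : IsForm T D h) {m : ℝ} {A : Finset κ} (hA : ∀ k ∉ A, m ≤ l k) {u : E} (hu : u ∈ D)
    (horth : ∀ k ∈ A, inner 𝕜 (b k) u = 0) : m * ‖u‖ ^ 2 ≤ h u := by
  classical
  -- Vectors approximating `u` need not be orthogonal to the `b k` with `k ∈ A`. The finite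
  -- correction sum makes the bound hold on the whole operator domain; it is norm continuous and
  -- vanishes at `u`.
  have hdom : ∀ v : T.domain, m * ‖(v : E)‖ ^ 2 +
      ∑ k ∈ A, (l k - m) * ‖inner 𝕜 (b k) (v : E)‖ ^ 2 ≤ quad T v := by
    intro v
    have h1 := (hasSum_norm_inner_sq b (v : E)).mul_left m
    have h2 : HasSum (fun k => if k ∈ A then (l k - m) * ‖inner 𝕜 (b k) (v : E)‖ ^ 2 else 0)
        (∑ k ∈ A, (l k - m) * ‖inner 𝕜 (b k) (v : E)‖ ^ 2) := by
      have := hasSum_sum_of_ne_finset_zero (s := A) (L := SummationFilter.unconditional κ)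
        (f := fun k => if k ∈ A then (l k - m) * ‖inner 𝕜 (b k) (v : E)‖ ^ 2 else 0)
        fun k hk => by simp [hk]
      convert this using 1
      exact Finset.sum_congr rfl fun k hk => by simp [hk]
    refine hasSum_le (fun k => ?_) (h1.add h2) (hasSum_quad hT hb v)
    by_cases hk : k ∈ A
    · simp only [hk, if_true]
      linarith
    · simp only [hk, if_false, add_zero]
      exact mul_le_mul_of_nonneg_right (hA k hk) (sq_nonneg _)
  obtain ⟨v, hv, hq⟩ := hh.exists_tendsto hu
  have hlim : Tendsto (fun n => m * ‖(v n : E)‖ ^ 2 +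
      ∑ k ∈ A, (l k - m) * ‖inner 𝕜 (b k) (v n : E)‖ ^ 2) atTop
      (𝓝 (m * ‖u‖ ^ 2 + ∑ k ∈ A, (l k - m) * ‖inner 𝕜 (b k) u‖ ^ 2)) := by
    refine ((hv.norm.pow 2).const_mul m).add (tendsto_finsetSum _ fun k _ => ?_)
    exact ((tendsto_const_nhds.inner hv).norm.pow 2).const_mul _
  rw [Finset.sum_eq_zero fun k hk => by simp [horth k hk], add_zero] at hlim
  exact le_of_tendsto_of_tendsto hlim hq (Eventually.of_forall fun n => hdom (v n))

theorem quad_le_of_inner_eq_zero (hT : IsSelfAdjoint T) (hb : IsEigenbasis T b l) {M : ℝ}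
    (u : T.domain) (hu : ∀ k, M < l k → inner 𝕜 (b k) (u : E) = 0) :
    quad T u ≤ M * ‖(u : E)‖ ^ 2 := by
  refine hasSum_le (fun k => ?_) (hasSum_quad hT hb u) ((hasSum_norm_inner_sq b (u : E)).mul_left M)
  rcases le_or_gt (l k) M with hk | hk
  · exact mul_le_mul_of_nonneg_right hk (sq_nonneg _)
  · simp [hu k hk]

/-- Comparison of eigenvalues: if the form of `T'` lies below the form of `T` by `c`, then so do
the ordered eigenvalues. -/
theorem eigenvalue_add_le {N : ℕ∞} {T T' : E →ₗ.[𝕜] E} (hT : IsSelfAdjoint T)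
    (hT' : IsSelfAdjoint T') {l l' : {n : ℕ // (n : ℕ∞) < N} → ℝ}
    (hl : HasOrderedEigenbasis T N l) (hl' : HasOrderedEigenbasis T' N l') {D : Set E}
    {h h' : E → ℝ} (hh : IsForm T D h) (hh' : IsForm T' D h') {c : ℝ}
    (hc : ∀ u ∈ D, h' u + c * ‖u‖ ^ 2 ≤ h u) (n : {n : ℕ // (n : ℕ∞) < N}) :
    l' n + c ≤ l n := by
  classical
  obtain ⟨hmono, b, hb⟩ := hl
  obtain ⟨hmono', b', hb'⟩ := hl'
  have hlt : ∀ i : ℕ, i ≤ n → (i : ℕ∞) < N := fun i hi =>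
    lt_of_le_of_lt (by exact_mod_cast hi) n.2
  let e : Fin (n + 1) → {n : ℕ // (n : ℕ∞) < N} := fun i => ⟨i, hlt i (Nat.lt_succ_iff.1 i.2)⟩
  let e' : Fin n → {n : ℕ // (n : ℕ∞) < N} := fun i => ⟨i, hlt i i.2.le⟩
  have he : Function.Injective e := fun i j hij => by
    simpa [e, Fin.ext_iff] using hij
  let L : (Fin (n + 1) → 𝕜) →ₗ[𝕜] E := Fintype.linearCombination 𝕜 (fun i => b (e i))
  let S : E →ₗ[𝕜] (Fin n → 𝕜) := LinearMap.pi fun j => (innerSL 𝕜 (b' (e' j))).toLinearMap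
  -- Dimension count: a combination of the first `n + 1` eigenvectors of `T` can satisfy the `n`
  -- conditions of orthogonality to the first `n` eigenvectors of `T'`.
  have hker : (S ∘ₗ L).ker ≠ ⊥ := LinearMap.ker_ne_bot_of_finrank_lt (by simp)
  obtain ⟨x, hx, hx0⟩ := (Submodule.ne_bot_iff _).1 hker
  set u : E := L x with hu
  have hLinj : Function.Injective L := linearIndependent_iff_injective_fintypeLinearCombination.1
    (b.orthonormal.linearIndependent.comp e he)
  have hu0 : u ≠ 0 := fun h0 => hx0 (hLinj (by rw [← hu, h0, map_zero]))
  have husum : u = ∑ i, x i • b (e i) := rfl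
  have hudom : u ∈ T.domain := by
    rw [husum]
    exact Submodule.sum_mem _ fun i _ => Submodule.smul_mem _ _ (hb (e i)).1
  have hupper : h u ≤ l n * ‖u‖ ^ 2 := by
    rw [hh.apply_eq ⟨u, hudom⟩]
    refine quad_le_of_inner_eq_zero hT hb ⟨u, hudom⟩ fun k hk => ?_
    have hnk : n < k := not_le.1 fun hkn => (hmono hkn).not_gt hk
    show inner 𝕜 (b k) u = 0
    rw [husum, inner_sum]
    refine Finset.sum_eq_zero fun i _ => ?_
    have hik : k ≠ e i := fun hki => by
      have h1 : (n : ℕ) < k := hnk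
      have h2 : (k : ℕ) = i := congrArg Subtype.val hki
      omega
    rw [inner_smul_right, b.orthonormal.2 hik, mul_zero]
  have hlower : l' n * ‖u‖ ^ 2 ≤ h' u := by
    refine hh'.le_apply hT' hb' (A := Finset.univ.image e') (fun k hk => hmono' ?_)
      (hh.mem ⟨u, hudom⟩) fun k hk => ?_
    · by_contra! hkn
      exact hk (Finset.mem_image.2 ⟨⟨k, hkn⟩, Finset.mem_univ _, rfl⟩)
    · obtain ⟨j, -, rfl⟩ := Finset.mem_image.1 hk
      exact congrFun (LinearMap.mem_ker.1 hx) j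
  have hpos : 0 < ‖u‖ ^ 2 := by positivity
  have := hc u (hh.mem ⟨u, hudom⟩)
  refine le_of_mul_le_mul_right ?_ hpos
  linarith

theorem spectralProj_apply_of_mem (hb : IsEigenbasis T b l) {I : Set ℝ} {n : κ} (hn : l n ∈ I) :
    spectralProj T I (b n) = b n := by
  obtain ⟨h, hTn⟩ := hb n
  exact Submodule.starProjection_eq_self_iff.2
    (Submodule.le_topologicalClosure _ (Submodule.subset_span ⟨h, l n, hn, hTn⟩))

/-- Eigenvectors of a self-adjoint operator with different eigenvalues are orthogonal. -/
theorem spectralProj_apply_of_notMem (hT : IsSelfAdjoint T) (hb : IsEigenbasis T b l) {I : Set ℝ}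
    {n : κ} (hn : l n ∉ I) : spectralProj T I (b n) = 0 := by
  obtain ⟨h, hTn⟩ := hb n
  refine (Submodule.starProjection_apply_eq_zero_iff _).2 ?_
  rw [Submodule.orthogonal_closure, Submodule.mem_orthogonal]
  intro u hu
  refine Submodule.span_induction ?_ (by simp) (fun x y _ _ hx hy => by rw [inner_add_left, hx, hy,
    add_zero]) (fun a x _ hx => by rw [inner_smul_left, hx, mul_zero]) hu
  rintro v ⟨hv, μ, hμ, hTv⟩
  have h1 := inner_apply_comm_of_isSelfAdjoint hT ⟨v, hv⟩ ⟨b n, h⟩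
  rw [hTv, hTn, inner_smul_left, inner_smul_right, RCLike.conj_ofReal] at h1
  have hne : (μ : 𝕜) - l n ≠ 0 := by
    rw [sub_ne_zero]
    exact fun heq => hn (by rwa [← RCLike.ofReal_inj.1 heq])
  exact (mul_eq_zero.1 (show ((μ : 𝕜) - l n) * inner 𝕜 v (b n) = 0 by
    rw [sub_mul, h1, sub_self])).resolve_left hne

/-- Expand in the eigenbasis, exchange the nonnegative sums, and apply Parseval to each `b n` in the
basis chosen by `posTrace`. -/
theorem posTrace_spectralProj (hT : IsSelfAdjoint T) (hb : IsEigenbasis T b l) (I : Set ℝ) :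
    posTrace (spectralProj T I) = ∑' n, Set.indicator {n | l n ∈ I} 1 n := by
  classical
  have hv : ∀ v : E, ENNReal.ofReal (RCLike.re (inner 𝕜 (spectralProj T I v) v)) =
      ∑' n, Set.indicator {n | l n ∈ I} 1 n * ENNReal.ofReal (‖inner 𝕜 v (b n)‖ ^ 2) := by
    intro v
    have h : HasSum (fun n => Set.indicator {n | l n ∈ I} 1 n * ‖inner 𝕜 v (b n)‖ ^ 2)
        (RCLike.re (inner 𝕜 (spectralProj T I v) v)) := by
      refine (RCLike.hasSum_re 𝕜 (b.hasSum_inner_mul_inner (spectralProj T I v) v)).congr_fun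
        fun n => ?_
      have hs : inner 𝕜 (spectralProj T I v) (b n) = inner 𝕜 v (spectralProj T I (b n)) :=
        Submodule.starProjection_isSymmetric _ v (b n)
      rw [hs]
      by_cases hn : l n ∈ I
      · rw [spectralProj_apply_of_mem hb hn, ← inner_conj_symm (b n) v, RCLike.mul_conj]
        simp only [Set.mem_ofPred_eq, hn, Set.indicator_of_mem, Pi.one_apply, one_mul]
        norm_cast
      · simp [spectralProj_apply_of_notMem hT hb hn, hn]
    rw [← h.tsum_eq, ENNReal.ofReal_tsum_of_nonneg (fun n => ?_) h.summable]
    · refine tsum_congr fun n => ?_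
      by_cases hn : l n ∈ I <;> simp [hn]
    · exact mul_nonneg (Set.indicator_nonneg (fun _ _ => zero_le_one) _) (sq_nonneg _)
  obtain ⟨B, hB⟩ := (exists_hilbertBasis 𝕜 E).choose_spec
  unfold posTrace
  simp only [hv]
  rw [ENNReal.tsum_comm]
  refine tsum_congr fun n => ?_
  rw [ENNReal.tsum_mul_left]
  have h1 := hasSum_norm_inner_sq B (b n)
  rw [hB, b.orthonormal.1 n] at h1
  rw [← ENNReal.ofReal_tsum_of_nonneg (fun _ => sq_nonneg _) h1.summable, h1.tsum_eq]
  simp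

end Eigenbasis

/-! ### All forms move in the same direction -/

section Dichotomy

variable {𝕜 E : Type*} [RCLike 𝕜] [NormedAddCommGroup E] [InnerProductSpace 𝕜 E]

/-- A difference of two forms on the same domain that dominates a multiple of `‖u‖ ^ 2` in absolute
value has a constant sign. -/
theorem IsForm.not_sub_neg_and_pos {T T' : E →ₗ.[𝕜] E} (hbdd : BoundedBelow T)
    (hbdd' : BoundedBelow T') {D : Set E} {h h' : E → ℝ} (hh : IsForm T D h)
    (hh' : IsForm T' D h') {c : ℝ} (hc : 0 < c) (hle : ∀ w ∈ D, c * ‖w‖ ^ 2 ≤ |h w - h' w|)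
    {u v : E} (hu : u ∈ D) (hv : v ∈ D) (hun : h u - h' u < 0) (hvp : 0 < h v - h' v) : False := by
  -- Along the segment from `u` to `v` the difference of forms is a polynomial in `s` with cross
  -- coefficient `k`. It has a zero, where the vector itself must vanish; then `u` and `v` are
  -- proportional, and homogeneity contradicts the opposite signs.
  set k := (h (u + v) - h' (u + v)) - (h u - h' u) - (h v - h' v)
  have hcombo : ∀ s : ℝ, h (((1 - s : ℝ) : 𝕜) • u + (s : 𝕜) • v) -
      h' (((1 - s : ℝ) : 𝕜) • u + (s : 𝕜) • v) =
      (1 - s) ^ 2 * (h u - h' u) + s ^ 2 * (h v - h' v) + (1 - s) * s * k := fun s => by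
    rw [(hh.smul_add_smul hbdd hu hv (1 - s) s).2, (hh'.smul_add_smul hbdd' hu hv (1 - s) s).2]
    ring
  have hcont : Continuous fun s : ℝ =>
      (1 - s) ^ 2 * (h u - h' u) + s ^ 2 * (h v - h' v) + (1 - s) * s * k := by fun_prop
  obtain ⟨s, -, hs0⟩ := intermediate_value_Icc (zero_le_one' ℝ) hcont.continuousOn
    (show (0 : ℝ) ∈ _ by constructor <;> simp [hun.le, hvp.le])
  have hw := hle _ (hh.smul_add_smul hbdd hu hv (1 - s) s).1
  simp only at hs0
  rw [hcombo, hs0, abs_zero] at hw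
  have hw0 : ((1 - s : ℝ) : 𝕜) • u + (s : 𝕜) • v = 0 := by
    have h1 := nonpos_of_mul_nonpos_right hw hc
    exact norm_eq_zero.1 (pow_eq_zero_iff two_ne_zero |>.1 (le_antisymm h1 (sq_nonneg _)))
  have heq : ((1 - s : ℝ) : 𝕜) • u + ((0 : ℝ) : 𝕜) • u = ((-s : ℝ) : 𝕜) • v + ((0 : ℝ) : 𝕜) • v := by
    rw [RCLike.ofReal_zero, zero_smul, zero_smul, add_zero, add_zero, RCLike.ofReal_neg, neg_smul]
    exact eq_neg_of_add_eq_zero_left hw0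
  have h1 := (hh.smul_add_smul hbdd hu hu (1 - s) 0).2
  have h2 := (hh.smul_add_smul hbdd hv hv (-s) 0).2
  have h1' := (hh'.smul_add_smul hbdd' hu hu (1 - s) 0).2
  have h2' := (hh'.smul_add_smul hbdd' hv hv (-s) 0).2
  rw [heq] at h1 h1'
  have hkey : (1 - s) ^ 2 * (h u - h' u) = s ^ 2 * (h v - h' v) := by linarith
  have hl : (1 - s) ^ 2 * (h u - h' u) ≤ 0 := mul_nonpos_of_nonneg_of_nonpos (sq_nonneg _) hun.le
  have hr : 0 ≤ s ^ 2 * (h v - h' v) := mul_nonneg (sq_nonneg _) hvp.le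
  have hs : s ^ 2 = 0 := (mul_eq_zero.1 (le_antisymm (hkey ▸ hl) hr)).resolve_right hvp.ne'
  have hs1 : (1 - s) ^ 2 = 0 :=
    (mul_eq_zero.1 (le_antisymm hl (hkey ▸ hr))).resolve_right hun.ne
  have e1 := pow_eq_zero_iff two_ne_zero |>.1 hs
  have e2 := pow_eq_zero_iff two_ne_zero |>.1 hs1
  linarith

variable {ι : Type*} {C : Set ℝ} {F : Finset ι} {H : (ι → C) → (E →ₗ.[𝕜] E)}
  {D : Set E} {f : E → (ι → C) → ℝ}

/-- One pair of points on a diagonal decides the direction for all `u`, by the sign argument applied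
to the two operators there. The zero vector satisfies both alternatives, so vectors violating one of
them are nonzero. -/
theorem forall_increasing_or_forall_decreasing (hbdd : ∀ ω, BoundedBelow (H ω))
    (hform : ∀ ω, IsForm (H ω) D fun u => f u ω) {γ : ℝ} (hγ : 0 < γ) {t : ℝ} (ht : 0 < t)
    {ω₁ ω₀ : ι → C} (hω : (fun α => (ω₀ α : ℝ)) = (fun α => (ω₁ α : ℝ)) - t • oneF F)
    (hmono : ∀ u ∈ D, (Monotone (f u) ∧ DiagIncreasing F (γ * ‖u‖ ^ 2) (f u)) ∨
      (Antitone (f u) ∧ DiagDecreasing F (γ * ‖u‖ ^ 2) (f u))) :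
    (∀ u ∈ D, Monotone (f u) ∧ DiagIncreasing F (γ * ‖u‖ ^ 2) (f u)) ∨
      ∀ u ∈ D, Antitone (f u) ∧ DiagDecreasing F (γ * ‖u‖ ^ 2) (f u) := by
  have hzero : ∀ u ∈ D, u = 0 → f u = 0 := by
    rintro u hu rfl
    funext ω
    simpa using ((hform ω).smul_add_smul (hbdd ω) hu hu 0 0).2
  by_contra! hcon
  obtain ⟨⟨u, hu, hnu⟩, v, hv, hnv⟩ := hcon
  have hu0 : u ≠ 0 := fun h0 => by
    refine hnu (by rw [hzero u hu h0]; exact fun _ _ _ => le_rfl) ?_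
    rw [hzero u hu h0, h0]
    intro ω ω' t _ _
    simp
  have hv0 : v ≠ 0 := fun h0 => by
    refine hnv (by rw [hzero v hv h0]; exact fun _ _ _ => le_rfl) ?_
    rw [hzero v hv h0, h0]
    intro ω ω' t _ _
    simp
  have hu' := ((hmono u hu).resolve_left fun h => hnu h.1 h.2).2 ω₁ ω₀ t ht.le hω
  have hv' := ((hmono v hv).resolve_right fun h => hnv h.1 h.2).2 ω₁ ω₀ t ht.le hω
  have hupos : 0 < t * (γ * ‖u‖ ^ 2) := by positivity
  have hvpos : 0 < t * (γ * ‖v‖ ^ 2) := by positivity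
  refine (hform ω₁).not_sub_neg_and_pos (hbdd ω₁) (hbdd ω₀) (hform ω₀) (mul_pos ht hγ)
    (fun w hw => ?_) hu hv (by linarith) (by linarith)
  rw [mul_assoc]
  rcases hmono w hw with h | h
  · exact (h.2 ω₁ ω₀ t ht.le hω).trans (le_abs_self _)
  · have := h.2 ω₁ ω₀ t ht.le hω
    exact le_trans (by linarith) (neg_le_abs _)

/-- If `F` is empty, none of the growth conditions holds with a positive constant. -/
theorem nonempty_of_growth {c : ℝ} (hc : 0 < c) [Nonempty (ι → C)] {f : (ι → C) → ℝ}
    (h : (Monotone f ∧ DiagIncreasing F c f) ∨ C1Increasing F c f ∨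
      (Antitone f ∧ DiagDecreasing F c f) ∨ C1Decreasing F c f) : F.Nonempty := by
  by_contra hF
  rw [Finset.not_nonempty_iff_eq_empty] at hF
  subst hF
  have hdiag : ∀ f : (ι → C) → ℝ, ¬ DiagIncreasing ∅ c f := fun f hf => by
    obtain ⟨ω⟩ := ‹Nonempty (ι → C)›
    have := hf ω ω 1 zero_le_one (by
      have : oneF (∅ : Finset ι) = 0 := by funext β; simp [oneF]
      simp [this])
    linarith
  have hC1 : ∀ f : (ι → C) → ℝ, ¬ C1Increasing ∅ c f := fun f ⟨g, _, hg⟩ => by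
    have := (hg (fun _ => 0) (by
      rw [show cube C (∅ : Finset ι) = Set.univ from
        Set.eq_univ_of_forall fun x α _ => absurd α.2 (Finset.notMem_empty _), interior_univ]
      trivial)).2
    simp at this
    linarith
  rcases h with h | h | h | h
  · exact hdiag f h.2
  · exact hC1 f h
  · exact hdiag _ (diagDecreasing_iff_neg.1 h.2)
  · exact hC1 _ h.neg

end Dichotomy

/-! ### Monotone eigenvalues and their concentration -/

section Eigenvalues

variable {𝕜 E ι : Type*} [RCLike 𝕜] [NormedAddCommGroup E] [InnerProductSpace 𝕜 E]
  [CompleteSpace E] {C : Set ℝ} {F : Finset ι} {H : (ι → C) → (E →ₗ.[𝕜] E)}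
  {N : ℕ∞} {lam : (ι → C) → {n : ℕ // (n : ℕ∞) < N} → ℝ} {D : Set E} {f : E → (ι → C) → ℝ}

theorem eigenvalue_le_of_monotone (hsa : ∀ ω, IsSelfAdjoint (H ω))
    (heig : ∀ ω, HasOrderedEigenbasis (H ω) N (lam ω))
    (hform : ∀ ω, IsForm (H ω) D fun u => f u ω) (hF : ∀ u ∈ D, DependsOnlyOn F (f u))
    (hmono : ∀ u ∈ D, Monotone (f u)) (n : {n : ℕ // (n : ℕ∞) < N}) {ω ω' : ι → C}
    (hω : ∀ α ∈ F, ω α ≤ ω' α) : lam ω n ≤ lam ω' n := by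
  classical
  -- The points are ordered only on `F`, so the coordinates of `ω'` outside `F` are first replaced
  -- by those of `ω`, which does not change `f u`.
  have key : ∀ u ∈ D, f u ω + 0 * ‖u‖ ^ 2 ≤ f u ω' := fun u hu => by
    rw [zero_mul, add_zero, ← hF u hu (F.piecewise ω' ω) ω' fun α hα => by simp [hα]]
    refine hmono u hu fun α => ?_
    by_cases hα : α ∈ F
    · simpa [hα] using hω α hα
    · simp [hα]
  simpa using eigenvalue_add_le (hsa ω') (hsa ω) (heig ω') (heig ω) (hform ω') (hform ω) key n

theorem eigenvalue_le_of_antitone (hsa : ∀ ω, IsSelfAdjoint (H ω))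
    (heig : ∀ ω, HasOrderedEigenbasis (H ω) N (lam ω))
    (hform : ∀ ω, IsForm (H ω) D fun u => f u ω) (hF : ∀ u ∈ D, DependsOnlyOn F (f u))
    (hmono : ∀ u ∈ D, Antitone (f u)) (n : {n : ℕ // (n : ℕ∞) < N}) {ω ω' : ι → C}
    (hω : ∀ α ∈ F, ω α ≤ ω' α) : lam ω' n ≤ lam ω n := by
  classical
  have key : ∀ u ∈ D, f u ω' + 0 * ‖u‖ ^ 2 ≤ f u ω := fun u hu => by
    rw [zero_mul, add_zero, ← hF u hu (F.piecewise ω' ω) ω' fun α hα => by simp [hα]]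
    refine hmono u hu fun α => ?_
    by_cases hα : α ∈ F
    · simpa [hα] using hω α hα
    · simp [hα]
  simpa using eigenvalue_add_le (hsa ω) (hsa ω') (heig ω) (heig ω') (hform ω) (hform ω') key n

variable [Countable ι] {P : Measure (ι → C)} [IsProbabilityMeasure P]

/-- The Wegner estimate for a single eigenvalue. -/
theorem nullMeasurable_eigenvalue_and_measure_le (hC : C.OrdConnected)
    (hP : Tendsto (modulus P F) (𝓝[>] 0) (𝓝 0))
    (hsa : ∀ ω, IsSelfAdjoint (H ω)) (hbdd : ∀ ω, BoundedBelow (H ω))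
    (heig : ∀ ω, HasOrderedEigenbasis (H ω) N (lam ω)) {I : Set ℝ} (hIopen : IsOpen I)
    (hIint : I.OrdConnected) (hform : ∀ ω, IsForm (H ω) D fun u => f u ω)
    (hF : ∀ u ∈ D, DependsOnlyOn F (f u)) {γ : ℝ} (hγ : 0 < γ)
    (hmono : ∀ u ∈ D, (Monotone (f u) ∧ DiagIncreasing F (γ * ‖u‖ ^ 2) (f u)) ∨
      C1Increasing F (γ * ‖u‖ ^ 2) (f u) ∨
      (Antitone (f u) ∧ DiagDecreasing F (γ * ‖u‖ ^ 2) (f u)) ∨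
      C1Decreasing F (γ * ‖u‖ ^ 2) (f u)) (n : {n : ℕ // (n : ℕ∞) < N}) :
    NullMeasurable (fun ω => lam ω n) P ∧
      P ((fun ω => lam ω n) ⁻¹' I) ≤ F.card * modulus P F (volume I / ENNReal.ofReal γ) := by
  classical
  have hΩ : Nonempty (ι → C) := nonempty_of_isProbabilityMeasure P
  obtain ⟨ω⟩ := id hΩ
  obtain ⟨-, b, hb⟩ := heig ω
  -- The index `n` provides a unit eigenvector, hence a strictly positive growth constant.
  have hFne : F.Nonempty := by
    refine nonempty_of_growth (c := γ * ‖b n‖ ^ 2) ?_ (hmono _ ((hform ω).mem ⟨b n, (hb n).1⟩))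
    rw [b.orthonormal.1 n]
    simpa using hγ
  obtain ⟨a₀, ha₀, a₁, ha₁, hlt⟩ := exists_lt_of_tendsto_modulus hP hFne
  have hdir : ∀ u ∈ D, (Monotone (f u) ∧ DiagIncreasing F (γ * ‖u‖ ^ 2) (f u)) ∨
      (Antitone (f u) ∧ DiagDecreasing F (γ * ‖u‖ ^ 2) (f u)) := fun u hu => by
    rcases hmono u hu with h | h | h | h
    · exact Or.inl h
    · exact Or.inl (h.monotone_and_diagIncreasing hC ha₀ ha₁ hlt)
    · exact Or.inr h
    · exact Or.inr (h.antitone_and_diagDecreasing hC ha₀ ha₁ hlt)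
  have hpair : (fun α => ((F.piecewise (fun _ => ⟨a₀, ha₀⟩) fun _ => ⟨a₁, ha₁⟩ : ι → C) α : ℝ)) =
      (fun _ => a₁) - (a₁ - a₀) • oneF F := by
    funext α
    by_cases hα : α ∈ F
    · simp [hα, oneF_of_mem hα]
    · simp [hα, oneF_of_notMem hα]
  rcases forall_increasing_or_forall_decreasing hbdd hform hγ (sub_pos.2 hlt)
    (ω₁ := fun _ => ⟨a₁, ha₁⟩) hpair hdir with h | h
  · have hΦ : ∀ ω ω' : ι → C, (∀ α ∈ F, ω α ≤ ω' α) → lam ω n ≤ lam ω' n := fun ω ω' hω =>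
      eigenvalue_le_of_monotone hsa heig hform hF (fun u hu => (h u hu).1) n hω
    refine ⟨nullMeasurable_of_monotoneOn hC hP hΦ,
      measure_preimage_le_of_diagIncreasing hC hP hγ hΦ (fun ω ω' t ht hω => ?_) hIopen hIint⟩
    have := eigenvalue_add_le (hsa ω) (hsa ω') (heig ω) (heig ω') (hform ω) (hform ω')
      (c := t * γ) (fun u hu => by
        have := (h u hu).2 ω ω' t ht hω
        linarith) n
    linarith
  · have hΦ : ∀ ω ω' : ι → C, (∀ α ∈ F, ω α ≤ ω' α) → -lam ω n ≤ -lam ω' n := fun ω ω' hω =>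
      neg_le_neg (eigenvalue_le_of_antitone hsa heig hform hF (fun u hu => (h u hu).1) n hω)
    constructor
    · have := measurable_neg.comp_nullMeasurable (nullMeasurable_of_monotoneOn hC hP hΦ)
      simpa [Function.comp_def] using this
    · have hI' : (Neg.neg ⁻¹' I : Set ℝ).OrdConnected :=
        hIint.preimage_anti fun x y hxy => neg_le_neg hxy
      have := measure_preimage_le_of_diagIncreasing hC hP hγ hΦ (fun ω ω' t ht hω => ?_)
        (hIopen.preimage continuous_neg) hI'
      · rw [Measure.measure_preimage_neg, ← Set.preimage_comp] at this
        simpa [Function.comp_def] using this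
      · have := eigenvalue_add_le (hsa ω') (hsa ω) (heig ω') (heig ω) (hform ω') (hform ω)
          (c := t * γ) (fun u hu => by
            have := (h u hu).2 ω ω' t ht hω
            linarith) n
        linarith

end Eigenvalues

end Wegner

theorem theorem2p2
    {𝕜 E ι : Type*} [RCLike 𝕜] [NormedAddCommGroup E] [InnerProductSpace 𝕜 E] [CompleteSpace E]
    [TopologicalSpace.SeparableSpace E] [Countable ι]
    -- the probability space, a product of copies of an interval
    (C : Set ℝ) (hC : C.OrdConnected)
    (P : Measure (ι → C)) [IsProbabilityMeasure P]
    (F : Finset ι)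
    (hP : Tendsto (Wegner.modulus P F) (𝓝[>] 0) (𝓝 0))
    -- the random operator and its eigenvalues
    (H : (ι → C) → (E →ₗ.[𝕜] E))
    (hsa : ∀ ω, IsSelfAdjoint (H ω))
    (hbdd : ∀ ω, Wegner.BoundedBelow (H ω))
    (N : ℕ∞) (lam : (ι → C) → {n : ℕ // (n : ℕ∞) < N} → ℝ)
    (heig : ∀ ω, Wegner.HasOrderedEigenbasis (H ω) N (lam ω))
    -- at most `K` eigenvalues in the open interval `I`; `lam ω n` is the eigenvalue number `n + 1`
    (I : Set ℝ) (hIopen : IsOpen I) (hIint : I.OrdConnected)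
    (K : ℝ≥0) (hK : ∀ ω (n : {n : ℕ // (n : ℕ∞) < N}), (K : ℝ) < (n : ℕ) + 1 → lam ω n ∉ I)
    -- constant operator domain or constant form domain
    (D : Set E) (f : E → (ι → C) → ℝ)
    (hD : (∀ ω, Wegner.IsOperatorForm (H ω) D fun u => f u ω) ∨
      (∀ ω, Wegner.IsAssociatedForm (H ω) D fun u => f u ω))
    -- dependence on the coordinates in `F`
    (hF : ∀ u ∈ D, Wegner.DependsOnlyOn F (f u))
    (γ : ℝ) (hγ : 0 < γ)
    (hmono : ∀ u ∈ D,
      (Monotone (f u) ∧ Wegner.DiagIncreasing F (γ * ‖u‖ ^ 2) (f u)) ∨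
      Wegner.C1Increasing F (γ * ‖u‖ ^ 2) (f u) ∨
      (Antitone (f u) ∧ Wegner.DiagDecreasing F (γ * ‖u‖ ^ 2) (f u)) ∨
      Wegner.C1Decreasing F (γ * ‖u‖ ^ 2) (f u)) :
    NullMeasurable (fun ω => Wegner.posTrace (Wegner.spectralProj (H ω) I)) P ∧
      ∫⁻ ω : NullMeasurableSpace (ι → C) P, Wegner.posTrace (Wegner.spectralProj (H ω) I)
          ∂P.completion ≤
        2 * (K : ℝ≥0∞) * (F.card : ℝ≥0∞) * Wegner.modulus P F (volume I / ENNReal.ofReal γ) := by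

  classical
  have hform : ∀ ω, Wegner.IsForm (H ω) D fun u => f u ω := fun ω =>
    hD.imp (fun h => h ω) (fun h => h ω)
  have hn := Wegner.nullMeasurable_eigenvalue_and_measure_le hC hP hsa hbdd heig hIopen hIint
    hform hF hγ hmono
  -- Indices start at zero, so those with `n + 1 ≤ K` are exactly the `n < ⌊K⌋₊`.
  set S : Finset {n : ℕ // (n : ℕ∞) < N} := (Finset.range ⌊K⌋₊).subtype _ with hS
  have hScard : (S.card : ℝ≥0∞) ≤ K := by
    have h1 : S.card ≤ ⌊K⌋₊ := by
      rw [hS, Finset.card_subtype]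
      exact (Finset.card_filter_le _ _).trans_eq (Finset.card_range _)
    have h2 : (S.card : ℝ≥0) ≤ K := (Nat.cast_le.2 h1).trans (Nat.floor_le zero_le)
    exact_mod_cast h2
  have htr : (fun ω => Wegner.posTrace (Wegner.spectralProj (H ω) I)) =
      fun ω => ∑ n ∈ S, Set.indicator ((fun ω => lam ω n) ⁻¹' I) 1 ω := by
    funext ω
    obtain ⟨-, b, hb⟩ := heig ω
    rw [Wegner.posTrace_spectralProj (hsa ω) hb, tsum_eq_sum (s := S)]
    · rfl
    · intro n hnS
      have hKn : (K : ℝ) < (n : ℕ) + 1 := by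
        have h1 : ⌊K⌋₊ ≤ n := by simpa [hS] using hnS
        have h2 : K < (n : ℕ) + 1 :=
          (Nat.lt_floor_add_one K).trans_le (by exact_mod_cast Nat.add_le_add_right h1 1)
        exact_mod_cast h2
      simp [hK ω n hKn]
  have hmeas : ∀ n, MeasurableSet (α := NullMeasurableSpace (ι → C) P)
      ((fun ω => lam ω n) ⁻¹' I) := fun n => (hn n).1 hIopen.measurableSet
  constructor
  · rw [htr]
    exact Finset.measurable_fun_sum (α := NullMeasurableSpace (ι → C) P) S fun n _ =>
      measurable_one.indicator (hmeas n)
  · calc ∫⁻ ω : NullMeasurableSpace (ι → C) P, Wegner.posTrace (Wegner.spectralProj (H ω) I)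
          ∂P.completion
        = ∫⁻ ω : NullMeasurableSpace (ι → C) P,
            ∑ n ∈ S, Set.indicator ((fun ω => lam ω n) ⁻¹' I) 1 ω ∂P.completion :=
          lintegral_congr fun ω => congrFun htr ω
      _ = ∑ n ∈ S, ∫⁻ ω : NullMeasurableSpace (ι → C) P,
            Set.indicator ((fun ω => lam ω n) ⁻¹' I) 1 ω ∂P.completion :=
          lintegral_finsetSum _ fun n _ => measurable_one.indicator (hmeas n)
      _ ≤ ∑ n ∈ S, (F.card : ℝ≥0∞) * Wegner.modulus P F (volume I / ENNReal.ofReal γ) := by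
          refine Finset.sum_le_sum fun n _ => ?_
          refine (lintegral_indicator_one (hmeas n)).trans_le ?_
          exact (Measure.completion_apply P _).trans_le (hn n).2
      _ = (S.card : ℝ≥0∞) * (F.card * Wegner.modulus P F (volume I / ENNReal.ofReal γ)) := by
          rw [Finset.sum_const, nsmul_eq_mul]
      _ ≤ 2 * K * (F.card * Wegner.modulus P F (volume I / ENNReal.ofReal γ)) := by
          gcongr
          -- The argument yields the constant `K`; the factor `2` is slack.
          exact hScard.trans (le_mul_of_one_le_left zero_le one_le_two)
      _ = _ := by ring
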